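/- Let $\mathbb S=\{x\in\mathbb R^3:\|x\|=1\}$ and let $\zeta(p,q)\in[0,\pi]$ be the spherical (great-circle) distance of $p,q\in\mathbb S$. For a finite set $S\subset\mathbb S$ with at least two points, the gap ratio of $S$ is $$\rho(S)=\frac{\max_{p\in\mathbb S}\,\min_{q\in S}\,2\,\zeta(p,q)}{\min_{p,q\in S,\;p\ne q}\zeta(p,q)},$$ the spherical diameter of the largest empty circle divided by the smallest distance between two points of $S$. In the online problem, pairwise distinct points $p_1,p_2,p_3,\dots$ are placed on $\mathbb S$ one after another, the number of points is not known in advance, and a point cannot be moved once it is placed; $S_i=\{p_1,\dots,p_i\}$. Theorem. The gap ratio for the online problem of placing four or more points on the sphere is greater than $1.726$, and the first four points already force this. Precisely: there is a constant $c>1.726$ such that, for every $n\ge 4$ and every sequence $p_1,\dots,p_n$ of pairwise distinct points of $\mathbb S$, $$\max_{2\le i\le 4}\rho(S_i)\ \ge\ c .$$ In particular, every online strategy satisfies $\rho(S_i)>1.726$ for some $i\in\{2,3,4\}$, and the infimum over all online strategies of the largest gap ratio that occurs is greater than $1.726$. -/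

import Mathlib

noncomputable section

/-- The unit `2`-sphere in Euclidean `3`-space. -/
abbrev UnitSphere : Type := Metric.sphere (0 : EuclideanSpace ℝ (Fin 3)) 1

/-- The spherical (orthodromic, great-circle) distance of two points of the unit sphere: the length
of the shorter great-circle arc between them, that is, the angle that they subtend at the centre. -/
def sphDist (p q : UnitSphere) : ℝ :=
  InnerProductGeometry.angle (p : EuclideanSpace ℝ (Fin 3)) (q : EuclideanSpace ℝ (Fin 3))

/-- The minimal gap: the least spherical distance between two distinct points of `S`
(a minimum for every finite `S` with at least two points). -/
def minGap (S : Set UnitSphere) : ℝ :=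
  sInf {d : ℝ | ∃ p ∈ S, ∃ q ∈ S, p ≠ q ∧ d = sphDist p q}

/-- The maximal gap: the spherical diameter of the largest empty circle, whose centre `p` may be
anywhere on the sphere, `max_p min_{q ∈ S} 2 * sphDist p q` (both extrema are attained for every
finite nonempty `S`). -/
def maxGap (S : Set UnitSphere) : ℝ :=
  ⨆ p : UnitSphere, ⨅ q : S, 2 * sphDist p q

/-- The gap ratio of a set of points on the sphere. -/
def gapRatio (S : Set UnitSphere) : ℝ :=
  maxGap S / minGap S

/-- The configuration after the first `i` of the `n` successive insertions `p 0, p 1, …`. -/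
def config {n : ℕ} (p : Fin n → UnitSphere) (i : ℕ) : Set UnitSphere :=
  {x | ∃ j : Fin n, (j : ℕ) < i ∧ p j = x}

end

/-! Suppose all three ratios are below c = 1.72605. Let the first three points lie on a circle of
larger spherical radius r ≥ π/2, with d the distance of the first two. The empty circles about the
antipode of the midpoint of the first two points, and about `-N`, give d > 2π/(1+c) and pairwise
distances > 2r/c > π/2. By the latter the three points cover the sphere within r
(`exists_sphDist_le_of_circumcentre`), so the fourth point is within r of one of them, while an
empty circle of radius π - r survives it; hence r > 2π/(2+c). The points are then far apart, so a
weighted sum of them is short; but the plane of their circle is far enough from the origin to force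
it to be long (Cauchy–Schwarz against `N`). -/

open Real InnerProductGeometry

/-! ### Taylor bounds -/

/-- A degree seven Taylor lower bound for the sine. -/
theorem Real.sin_ge_taylor_seven {x : ℝ} (hx : 0 ≤ x) :
    x - x ^ 3 / 6 + x ^ 5 / 120 - x ^ 7 / 5040 ≤ Real.sin x := by
  -- Each bound follows from the previous one: the difference vanishes at 0 and has nonnegative
  -- derivative.
  have mono : ∀ f : ℝ → ℝ, Differentiable ℝ f → (∀ t, 0 < t → 0 ≤ deriv f t) →
      ∀ x, 0 ≤ x → f 0 ≤ f x := by
    intro f hf hd x hx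
    refine monotoneOn_of_deriv_nonneg (convex_Ici 0) hf.continuous.continuousOn
      hf.differentiableOn (fun t ht => hd t ?_) Set.self_mem_Ici hx hx
    simpa using ht
  have h4 : ∀ x : ℝ, 0 ≤ x → cos x ≤ 1 - x ^ 2 / 2 + x ^ 4 / 24 := by
    intro x hx
    have := mono (fun t => 1 - t ^ 2 / 2 + t ^ 4 / 24 - cos t) (by fun_prop) (by
      intro t ht
      have hd : deriv (fun t => 1 - t ^ 2 / 2 + t ^ 4 / 24 - cos t) t
          = sin t - (t - t ^ 3 / 6) := by
        simp (disch := fun_prop)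
        ring
      rw [hd]
      linarith [sin_ge_sub_cube ht.le]) x hx
    norm_num at this
    linarith
  have h5 : ∀ x : ℝ, 0 ≤ x → sin x ≤ x - x ^ 3 / 6 + x ^ 5 / 120 := by
    intro x hx
    have := mono (fun t => t - t ^ 3 / 6 + t ^ 5 / 120 - sin t) (by fun_prop) (by
      intro t ht
      have hd : deriv (fun t => t - t ^ 3 / 6 + t ^ 5 / 120 - sin t) t
          = 1 - t ^ 2 / 2 + t ^ 4 / 24 - cos t := by
        simp (disch := fun_prop)
        ring
      rw [hd]
      linarith [h4 t ht.le]) x hx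
    norm_num at this
    linarith
  have h6 : ∀ x : ℝ, 0 ≤ x → 1 - x ^ 2 / 2 + x ^ 4 / 24 - x ^ 6 / 720 ≤ cos x := by
    intro x hx
    have := mono (fun t => cos t - (1 - t ^ 2 / 2 + t ^ 4 / 24 - t ^ 6 / 720)) (by fun_prop) (by
      intro t ht
      have hd : deriv (fun t => cos t - (1 - t ^ 2 / 2 + t ^ 4 / 24 - t ^ 6 / 720)) t
          = t - t ^ 3 / 6 + t ^ 5 / 120 - sin t := by
        simp (disch := fun_prop)
        ring
      rw [hd]
      linarith [h5 t ht.le]) x hx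
    norm_num at this
    linarith
  have := mono (fun t => sin t - (t - t ^ 3 / 6 + t ^ 5 / 120 - t ^ 7 / 5040)) (by fun_prop) (by
    intro t ht
    have hd : deriv (fun t => sin t - (t - t ^ 3 / 6 + t ^ 5 / 120 - t ^ 7 / 5040)) t
        = cos t - (1 - t ^ 2 / 2 + t ^ 4 / 24 - t ^ 6 / 720) := by
      simp (disch := fun_prop)
      ring
    rw [hd]
    linarith [h6 t ht.le]) x hx
  norm_num at this
  linarith

/-- An upper bound for the cosine of an angle that exceeds `π / 2` by at least `y`. -/
theorem Real.cos_le_neg_taylor {x y : ℝ} (hy : 0 ≤ y) (hxy : π / 2 + y ≤ x) (hx : x ≤ π) :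
    cos x ≤ -(y - y ^ 3 / 6 + y ^ 5 / 120 - y ^ 7 / 5040) := by
  have h1 := cos_le_cos_of_nonneg_of_le_pi (by linarith [pi_pos]) hx hxy
  rw [add_comm, cos_add_pi_div_two] at h1
  linarith [Real.sin_ge_taylor_seven hy]

/-! ### Obtuse systems and circumcentres -/

/-- A linear dependence of vectors that pairwise subtend no acute angle can be taken
with nonnegative coefficients. -/
theorem exists_nonneg_relation_of_inner_nonpos {E ι : Type*} [NormedAddCommGroup E]
    [InnerProductSpace ℝ E] [Fintype ι] {v : ι → E}
    (hv : ∀ i j, i ≠ j → inner ℝ (v i) (v j) ≤ 0) (hd : ¬ LinearIndependent ℝ v) :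
    ∃ μ : ι → ℝ, (∀ i, 0 ≤ μ i) ∧ (∃ i, μ i ≠ 0) ∧ ∑ i, μ i • v i = 0 := by
  obtain ⟨g, hg, i, hi⟩ := Fintype.not_linearIndependent_iff.1 hd
  refine ⟨fun i => |g i|, fun i => abs_nonneg _, ⟨i, by simpa using hi⟩, ?_⟩
  have expand : ∀ a : ι → ℝ, inner ℝ (∑ i, a i • v i) (∑ i, a i • v i)
      = ∑ i, ∑ j, a i * a j * inner ℝ (v i) (v j) := by
    intro a
    simp only [sum_inner, inner_sum, real_inner_smul_left, real_inner_smul_right]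
    exact Finset.sum_congr rfl fun i _ => Finset.sum_congr rfl fun j _ => by
      rw [real_inner_comm]
      ring
  -- Passing to `|g i|` keeps the diagonal terms and cannot increase the others, so the sum still
  -- vanishes.
  have hle : inner ℝ (∑ i, |g i| • v i) (∑ i, |g i| • v i) ≤ (0 : ℝ) := by
    calc inner ℝ (∑ i, |g i| • v i) (∑ i, |g i| • v i)
        = ∑ i, ∑ j, |g i| * |g j| * inner ℝ (v i) (v j) := expand _
      _ ≤ ∑ i, ∑ j, g i * g j * inner ℝ (v i) (v j) := by
          refine Finset.sum_le_sum fun i _ => Finset.sum_le_sum fun j _ => ?_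
          by_cases hij : i = j
          · subst hij
            rw [abs_mul_abs_self]
          · rw [← abs_mul]
            exact mul_le_mul_of_nonpos_right (le_abs_self _) (hv i j hij)
      _ = 0 := by rw [← expand, hg, inner_zero_left]
  exact inner_self_eq_zero.1 (le_antisymm hle real_inner_self_nonneg)

/-- Three points of the sphere lie on a circle whose centre `N` is a point of the sphere,
chosen in the closed hemisphere that contains the circle. -/
theorem exists_circumcentre (p : Fin 3 → UnitSphere) :
    ∃ (N : UnitSphere) (t : ℝ), 0 ≤ t ∧
      ∀ i, inner ℝ (N : EuclideanSpace ℝ (Fin 3)) (p i : EuclideanSpace ℝ (Fin 3)) = t := by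
  let E := EuclideanSpace ℝ (Fin 3)
  let f : E →ₗ[ℝ] ℝ × ℝ :=
    ((innerSL ℝ ((p 1 : E) - p 0)).toLinearMap).prod ((innerSL ℝ ((p 2 : E) - p 0)).toLinearMap)
  -- Two linear conditions in dimension three: a common normal of the two chords.
  have hker : f.ker ≠ ⊥ := LinearMap.ker_ne_bot_of_finrank_lt (by simp [E])
  obtain ⟨x, hx, hx0⟩ := Submodule.exists_mem_ne_zero_of_ne_bot hker
  have hxf : inner ℝ ((p 1 : E) - p 0) x = (0 : ℝ) ∧ inner ℝ ((p 2 : E) - p 0) x = (0 : ℝ) := by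
    exact Prod.mk.inj hx
  simp only [inner_sub_left, sub_eq_zero] at hxf
  have hn : ‖x‖ ≠ 0 := norm_ne_zero_iff.2 hx0
  have key : ∀ s : ℝ, s ^ 2 = 1 → ∀ i : Fin 3,
      inner ℝ ((s * ‖x‖⁻¹) • x) (p i : E) = s * (‖x‖⁻¹ * inner ℝ (p 0 : E) x) := by
    intro s _ i
    rw [real_inner_smul_left, real_inner_comm]
    fin_cases i <;> simp [hxf, mul_assoc]
  have mem : ∀ s : ℝ, s ^ 2 = 1 → (s * ‖x‖⁻¹) • x ∈ Metric.sphere (0 : E) 1 := by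
    intro s hs
    have : |s| = 1 := by
      have := sq_abs s
      nlinarith [abs_nonneg s]
    simp [norm_smul, this, hn]
  rcases le_total 0 (‖x‖⁻¹ * inner ℝ (p 0 : E) x) with h | h
  · exact ⟨⟨_, mem 1 (by norm_num)⟩, _, by rw [one_mul]; exact h, key 1 (by norm_num)⟩
  · exact ⟨⟨_, mem (-1) (by norm_num)⟩, _, by linarith, key (-1) (by norm_num)⟩

/-! ### Spherical distance and gaps -/

theorem sphDist_nonneg (p q : UnitSphere) : 0 ≤ sphDist p q := angle_nonneg _ _

theorem sphDist_le_pi (p q : UnitSphere) : sphDist p q ≤ π := angle_le_pi _ _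

theorem cos_sphDist (p q : UnitSphere) : cos (sphDist p q) =
    inner ℝ (p : EuclideanSpace ℝ (Fin 3)) (q : EuclideanSpace ℝ (Fin 3)) := by
  rw [sphDist, cos_angle]
  simp

theorem sphDist_eq_arccos (p q : UnitSphere) : sphDist p q =
    arccos (inner ℝ (p : EuclideanSpace ℝ (Fin 3)) (q : EuclideanSpace ℝ (Fin 3))) := by
  rw [← cos_sphDist, arccos_cos (sphDist_nonneg p q) (sphDist_le_pi p q)]

theorem sphDist_neg_left (p q : UnitSphere) : sphDist (-p) q = π - sphDist p q :=
  angle_neg_left _ _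

theorem sphDist_pos {p q : UnitSphere} (h : p ≠ q) : 0 < sphDist p q := by
  refine lt_of_le_of_ne (sphDist_nonneg p q) fun h0 => h (Subtype.ext ?_)
  exact eq_of_angle_eq_zero_of_norm_eq h0.symm (by simp)

/-- Two points of the sphere have a point at distance `π - sphDist p q / 2` from both. -/
theorem exists_sphDist_eq_pi_sub_half (p q : UnitSphere) (hpq : sphDist p q < π) :
    ∃ P : UnitSphere, sphDist P p = π - sphDist p q / 2 ∧ sphDist P q = π - sphDist p q / 2 := by
  let E := EuclideanSpace ℝ (Fin 3)
  set d := sphDist p q with hd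
  have hd0 : 0 ≤ d := sphDist_nonneg p q
  have hc : 0 < cos (d / 2) := cos_pos_of_mem_Ioo ⟨by linarith [pi_pos], by linarith⟩
  have hcos : cos d = 2 * cos (d / 2) ^ 2 - 1 := by rw [← cos_two_mul]; ring_nf
  have hin : inner ℝ (p : E) (q : E) = 2 * cos (d / 2) ^ 2 - 1 := by
    rw [← hcos, hd, cos_sphDist]
  have hpp : inner ℝ (p : E) (p : E) = (1 : ℝ) := by simp
  have hqq : inner ℝ (q : E) (q : E) = (1 : ℝ) := by simp
  have hqp : inner ℝ (q : E) (p : E) = 2 * cos (d / 2) ^ 2 - 1 := by rw [real_inner_comm, hin]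
  have hnorm : ‖(p : E) + q‖ = 2 * cos (d / 2) := by
    have h2 : ‖(p : E) + q‖ ^ 2 = (2 * cos (d / 2)) ^ 2 := by
      rw [← real_inner_self_eq_norm_sq]
      simp only [inner_add_left, inner_add_right, hpp, hqq, hqp, hin]
      ring
    exact (pow_left_inj₀ (norm_nonneg _) (by linarith) two_ne_zero).1 h2
  -- The witness is the antipode of this midpoint of the arc.
  have hP : (2 * cos (d / 2))⁻¹ • ((p : E) + q) ∈ Metric.sphere (0 : E) 1 := by
    rw [mem_sphere_zero_iff_norm, norm_smul, hnorm, norm_inv, Real.norm_of_nonneg (by linarith)]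
    exact inv_mul_cancel₀ (by linarith)
  have harc : arccos (cos (d / 2)) = d / 2 := arccos_cos (by linarith) (by linarith [pi_pos])
  refine ⟨-⟨_, hP⟩, ?_, ?_⟩ <;> rw [sphDist_neg_left, sphDist_eq_arccos] <;>
    congr 1 <;> refine Eq.trans (congrArg arccos ?_) harc
  · simp only [real_inner_smul_left, inner_add_left, hpp, hqp]
    field_simp
    ring_nf
  · simp only [real_inner_smul_left, inner_add_left, hqq, hin]
    field_simp
    ring_nf

theorem two_mul_le_maxGap {S : Set UnitSphere} (hS : S.Nonempty) {P : UnitSphere} {r : ℝ}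
    (h : ∀ q ∈ S, r ≤ sphDist P q) : 2 * r ≤ maxGap S := by
  have : Nonempty S := hS.to_subtype
  have hbdd : BddAbove (Set.range fun p : UnitSphere => ⨅ q : S, 2 * sphDist p q) := by
    refine ⟨2 * π, ?_⟩
    rintro _ ⟨p, rfl⟩
    obtain ⟨q⟩ := this
    refine ciInf_le_of_le ⟨0, ?_⟩ q (by linarith [sphDist_le_pi p q])
    rintro _ ⟨q, rfl⟩
    have := sphDist_nonneg p q
    dsimp only
    linarith
  refine le_trans (le_ciInf fun q => ?_) (le_ciSup hbdd P)
  linarith [h q q.2]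

theorem minGap_le {S : Set UnitSphere} {p q : UnitSphere} (hp : p ∈ S) (hq : q ∈ S)
    (hpq : p ≠ q) : minGap S ≤ sphDist p q := by
  refine csInf_le ⟨0, ?_⟩ ⟨p, hp, q, hq, hpq, rfl⟩
  rintro _ ⟨a, _, b, _, _, rfl⟩
  exact sphDist_nonneg a b

theorem minGap_pos {S : Set UnitSphere} (hS : S.Finite) (hS' : S.Nontrivial) : 0 < minGap S := by
  obtain ⟨p, hp, q, hq, hpq⟩ := hS'
  have hne : {d : ℝ | ∃ p ∈ S, ∃ q ∈ S, p ≠ q ∧ d = sphDist p q}.Nonempty :=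
    ⟨_, p, hp, q, hq, hpq, rfl⟩
  have hfin : {d : ℝ | ∃ p ∈ S, ∃ q ∈ S, p ≠ q ∧ d = sphDist p q}.Finite := by
    refine (hS.image2 sphDist hS).subset ?_
    rintro _ ⟨a, ha, b, hb, _, rfl⟩
    exact Set.mem_image2_of_mem ha hb
  obtain ⟨a, _, b, _, hab, h⟩ := hne.csInf_mem hfin
  rw [minGap, h]
  exact sphDist_pos hab

/-- If the gap ratio is less than `c`, then the empty circles are small compared
with the distances in the configuration. -/
theorem two_mul_lt_of_gapRatio_lt {S : Set UnitSphere} (hS : S.Finite) {c : ℝ} (hc : 0 < c)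
    (h : gapRatio S < c) {P : UnitSphere} {r : ℝ} (hr : ∀ q ∈ S, r ≤ sphDist P q)
    {p q : UnitSphere} (hp : p ∈ S) (hq : q ∈ S) (hpq : p ≠ q) : 2 * r < c * sphDist p q := by
  have h1 := (div_lt_iff₀ (minGap_pos hS ⟨p, hp, q, hq, hpq⟩)).1 h
  have h2 := two_mul_le_maxGap ⟨p, hp⟩ hr
  have h3 := mul_le_mul_of_nonneg_left (minGap_le hp hq hpq) hc.le
  linarith

/-! ### Covering by three points -/

/-- If three points of a circle pairwise subtend angles of at least `π / 2`, then every point of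
the sphere is within the larger spherical radius of the circle from one of them. -/
theorem exists_sphDist_le_of_circumcentre {p : Fin 3 → UnitSphere} {N : UnitSphere} {t : ℝ}
    (ht : 0 ≤ t)
    (hN : ∀ i, inner ℝ (N : EuclideanSpace ℝ (Fin 3)) (p i : EuclideanSpace ℝ (Fin 3)) = t)
    (hp : ∀ i j, i ≠ j →
      inner ℝ (p i : EuclideanSpace ℝ (Fin 3)) (p j : EuclideanSpace ℝ (Fin 3)) ≤ 0)
    (x : UnitSphere) : ∃ i, sphDist (p i) x ≤ arccos (-t) := by
  let E := EuclideanSpace ℝ (Fin 3)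
  by_contra! hx
  have hlt : ∀ i, inner ℝ (p i : E) (x : E) < -t := by
    intro i
    by_contra! hi
    have := arccos_le_arccos hi
    rw [← sphDist_eq_arccos] at this
    exact (hx i).not_ge this
  have hN' : ∀ i, inner ℝ (p i : E) (N : E) = t := fun i => by rw [real_inner_comm, hN i]
  -- Four pairwise non-acute vectors in dimension three. Pairing the relation with `N` gives μ₀ = t
  -- ∑ μᵢ; pairing with `x` gives ∑ μᵢ⟨pᵢ, x⟩ = μ₀⟨N, x⟩ ≥ -t ∑ μᵢ, against `hlt`.
  obtain ⟨μ, hμ, ⟨k, hk⟩, hsum⟩ := exists_nonneg_relation_of_inner_nonpos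
    (v := (Fin.cons (-(N : E)) (fun i => (p i : E)) : Fin 4 → E)) (by
      intro i j hij
      cases i using Fin.cases <;> cases j using Fin.cases
      · exact absurd rfl hij
      · simpa [hN] using ht
      · simpa [hN'] using ht
      · simpa using hp _ _ (fun h => hij (congrArg _ h))) (by
      intro hli
      have := hli.fintype_card_le_finrank
      simp [E] at this)
  rw [Fin.sum_univ_succ] at hsum
  simp only [Fin.cons_zero, Fin.cons_succ] at hsum
  have e1 := congrArg (fun y => inner ℝ y (N : E)) hsum
  have e2 := congrArg (fun y => inner ℝ y (x : E)) hsum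
  simp only [inner_add_left, sum_inner, real_inner_smul_left, inner_neg_left, inner_zero_left,
    hN', ← Finset.sum_mul] at e1 e2
  have hNN : inner ℝ (N : E) (N : E) = (1 : ℝ) := by simp
  rw [hNN] at e1
  have hNx : inner ℝ (N : E) (x : E) ≥ (-1 : ℝ) := by
    rw [← cos_sphDist]
    exact neg_one_le_cos _
  have hpos : ∃ i : Fin 3, 0 < μ i.succ := by
    by_contra! hz
    have hz' : ∀ i : Fin 3, μ i.succ = 0 := fun i => le_antisymm (hz i) (hμ _)
    have h0 : μ 0 = 0 := by simpa [hz'] using e1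
    exact hk (Fin.cases h0 hz' k)
  obtain ⟨i, hi⟩ := hpos
  have hlt' : ∑ i : Fin 3, μ i.succ * inner ℝ (p i : E) (x : E) < ∑ i : Fin 3, μ i.succ * (-t) :=
    Finset.sum_lt_sum (fun j _ => mul_le_mul_of_nonneg_left (hlt j).le (hμ _))
      ⟨i, Finset.mem_univ _, mul_lt_mul_of_pos_left (hlt i) hi⟩
  rw [← Finset.sum_mul] at hlt'
  nlinarith [hμ 0]

/-! ### Numerical contradiction and conclusion -/

/-- The numerical heart of the bound: the norm of `p + q + 0.785 • r` for unit vectors at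
distances `d`, `e`, `f` is too small for a circle of larger spherical radius `r`. -/
theorem sq_lt_of_distances {d e f r : ℝ} (hd : d ≤ π) (he : e ≤ π) (hf : f ≤ π) (hr : r ≤ π)
    (h2 : 2 * (π - d / 2) < 1.72605 * d) (h4 : 2 * (π - r) < 1.72605 * r)
    (h3e : 2 * r < 1.72605 * e) (h3f : 2 * r < 1.72605 * f) :
    2 + 2 * cos d + 0.785 ^ 2 + 2 * 0.785 * (cos e + cos f) < (2.785 * cos r) ^ 2 := by
  have hπ := pi_gt_d6
  -- The values of `y` are 2π/(1+c), 4π/(c(2+c)) and 2π/(2+c), each less π/2, rounded down.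
  have c1 := cos_le_neg_taylor (x := d) (y := 0.734071) (by norm_num) (by linarith) hd
  have c2 := cos_le_neg_taylor (x := e) (y := 0.383128) (by norm_num) (by linarith) he
  have c3 := cos_le_neg_taylor (x := f) (y := 0.383128) (by norm_num) (by linarith) hf
  have c4 := cos_le_neg_taylor (x := r) (y := 0.115489) (by norm_num) (by linarith) hr
  have c5 : (0.3209 : ℝ) ≤ 2.785 * -cos r := by
    norm_num at c4 ⊢
    linarith
  have c6 := pow_le_pow_left₀ (by norm_num) c5 2
  norm_num at c1 c2 c3 c6 ⊢
  linarith

/-- Four distinct points of the sphere cannot keep the gap ratio below `1.72605` after two,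
three and four insertions. -/
theorem exists_le_gapRatio {p : Fin 3 → UnitSphere} {x : UnitSphere}
    (hp : Function.Injective p) (hx : ∀ i, p i ≠ x)
    (h2 : gapRatio {p 0, p 1} < 1.72605) (h3 : gapRatio {p 0, p 1, p 2} < 1.72605)
    (h4 : gapRatio {p 0, p 1, p 2, x} < 1.72605) : False := by
  let E := EuclideanSpace ℝ (Fin 3)
  obtain ⟨N, t, ht, hN⟩ := exists_circumcentre p
  have hπ := pi_gt_d6
  set r := arccos (-t) with hr
  have hrπ : r ≤ π := arccos_le_pi _
  have hr2 : π / 2 ≤ r := by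
    rw [← arccos_zero]
    exact arccos_le_arccos (by linarith)
  have hNd : ∀ i, sphDist N (p i) = π - r := fun i => by
    rw [sphDist_eq_arccos, hN, hr, arccos_neg]
    ring
  have hNd' : ∀ i, sphDist (-N) (p i) = r := fun i => by rw [sphDist_neg_left, hNd]; ring
  have g3 : ∀ i j, i ≠ j → 2 * r < 1.72605 * sphDist (p i) (p j) := by
    intro i j hij
    refine two_mul_lt_of_gapRatio_lt (by simp) (by norm_num) h3 (P := -N) ?_ ?_ ?_ (hp.ne hij)
    · simp [hNd']
    · fin_cases i <;> simp
    · fin_cases j <;> simp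
  have g4 : ∀ i, 2 * (π - r) < 1.72605 * sphDist (p i) x := by
    intro i
    -- If `x` lies in the cap of radius π - r about `N`, it is at least r ≥ π - r from `-N`.
    obtain ⟨P, hP⟩ : ∃ P, ∀ q ∈ ({p 0, p 1, p 2, x} : Set UnitSphere), π - r ≤ sphDist P q := by
      rcases le_total (π - r) (sphDist N x) with h | h
      · refine ⟨N, ?_⟩
        simp only [Set.forall_mem_insert, Set.mem_singleton_iff, forall_eq, hNd]
        exact ⟨le_rfl, le_rfl, le_rfl, h⟩
      · refine ⟨-N, ?_⟩
        simp only [Set.forall_mem_insert, Set.mem_singleton_iff, forall_eq, hNd',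
          sphDist_neg_left N x]
        refine ⟨?_, ?_, ?_, ?_⟩ <;> linarith
    refine two_mul_lt_of_gapRatio_lt (by simp) (by norm_num) h4 hP ?_ (by simp) (hx i)
    fin_cases i <;> simp
  have g2 : 2 * (π - sphDist (p 0) (p 1) / 2) < 1.72605 * sphDist (p 0) (p 1) := by
    rcases (sphDist_le_pi (p 0) (p 1)).lt_or_eq with h | h
    · obtain ⟨P, hP0, hP1⟩ := exists_sphDist_eq_pi_sub_half _ _ h
      exact two_mul_lt_of_gapRatio_lt (by simp) (by norm_num) h2 (P := P)
        (by simp [hP0, hP1]) (by simp) (by simp) (hp.ne (by decide))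
    · rw [h]
      linarith
  obtain ⟨k, hk⟩ := exists_sphDist_le_of_circumcentre ht hN (fun i j hij => by
    rw [← cos_sphDist]
    exact cos_nonpos_of_pi_div_two_le_of_le (by linarith [g3 i j hij])
      (by linarith [sphDist_le_pi (p i) (p j)])) x
  have hlt := sq_lt_of_distances (sphDist_le_pi (p 0) (p 1)) (sphDist_le_pi (p 0) (p 2))
    (sphDist_le_pi (p 1) (p 2)) hrπ g2 (by linarith [g4 k]) (g3 0 2 (by decide))
    (g3 1 2 (by decide))
  have ht1 : t ≤ 1 := by
    rw [← hN 0, ← cos_sphDist]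
    exact cos_le_one _
  have hcr : cos r = -t := cos_arccos (by linarith) (by linarith)
  -- The weight 0.785 nearly minimises the norm of the sum relative to its total weight at the
  -- extremal distances.
  have cs := real_inner_mul_inner_self_le (N : E) ((p 0 : E) + p 1 + (0.785 : ℝ) • (p 2 : E))
  have hself : ∀ q : UnitSphere, inner ℝ (q : E) (q : E) = (1 : ℝ) := by simp
  simp only [inner_add_left, inner_add_right, real_inner_smul_left, real_inner_smul_right, hN,
    hself, ← cos_sphDist] at cs
  rw [hcr] at hlt
  have c10 : sphDist (p 1) (p 0) = sphDist (p 0) (p 1) := angle_comm _ _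
  have c20 : sphDist (p 2) (p 0) = sphDist (p 0) (p 2) := angle_comm _ _
  have c21 : sphDist (p 2) (p 1) = sphDist (p 1) (p 2) := angle_comm _ _
  rw [c10, c20, c21] at cs
  linarith

/-- Whatever the online strategy, one of the configurations after two, three or four insertions has
gap ratio at least `c`, where `c > 1.726` does not depend on the strategy. -/
theorem mainTheorem4 :
    ∃ c : ℝ, 1.726 < c ∧
      ∀ n : ℕ, 4 ≤ n → ∀ p : Fin n → UnitSphere, Function.Injective p →
        ∃ i : ℕ, 2 ≤ i ∧ i ≤ 4 ∧ c ≤ gapRatio (config p i) := by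
  refine ⟨1.72605, by norm_num, fun n hn p hp => ?_⟩
  by_contra! h
  have hlt : ∀ {j : ℕ}, j < 4 → j < n := fun hj => hj.trans_le hn
  have e2 : config p 2 = {p ⟨0, hlt (by simp)⟩, p ⟨1, hlt (by simp)⟩} := by
    ext y
    constructor
    · rintro ⟨⟨j, _⟩, hj, rfl⟩
      dsimp only at hj
      interval_cases j <;> simp
    · rintro (rfl | rfl) <;> exact ⟨_, by simp, rfl⟩
  have e3 : config p 3 =
      {p ⟨0, hlt (by simp)⟩, p ⟨1, hlt (by simp)⟩, p ⟨2, hlt (by simp)⟩} := by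
    ext y
    constructor
    · rintro ⟨⟨j, _⟩, hj, rfl⟩
      dsimp only at hj
      interval_cases j <;> simp
    · rintro (rfl | rfl | rfl) <;> exact ⟨_, by simp, rfl⟩
  have e4 : config p 4 = {p ⟨0, hlt (by simp)⟩, p ⟨1, hlt (by simp)⟩, p ⟨2, hlt (by simp)⟩,
      p ⟨3, hlt (by simp)⟩} := by
    ext y
    constructor
    · rintro ⟨⟨j, _⟩, hj, rfl⟩
      dsimp only at hj
      interval_cases j <;> simp
    · rintro (rfl | rfl | rfl | rfl) <;> exact ⟨_, by simp, rfl⟩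
  refine exists_le_gapRatio (p := fun i => p ⟨i, hlt (by omega)⟩) (x := p ⟨3, hlt (by simp)⟩)
    (fun i j hij => ?_) (fun i hi => ?_) (e2 ▸ h 2 (by simp) (by simp))
    (e3 ▸ h 3 (by simp) (by simp)) (e4 ▸ h 4 (by simp) (by simp))
  · exact Fin.ext (Fin.mk.inj (hp hij))
  · have := congrArg Fin.val (hp hi)
    simp only at this
    omega
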